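/- Let $\mathcal G=(\mathcal V,\mathcal I,\mathcal E,\partial)$ be a finite metric graph with finite sets of vertices $\mathcal V$, internal edges $\mathcal I$ and external edges $\mathcal E$; each $i\in\mathcal I$ is identified with an interval $[0,a_i]$, $a_i\in(0,\infty)$, joining its initial to its terminal vertex, and each $e\in\mathcal E$ with a half-line $[0,\infty)$ starting at its vertex. Write $I_j$ for the interval of the edge $j$, $\mathcal H=\bigoplus_{j\in\mathcal E\cup\mathcal I}L^2(I_j;\mathbb C)$, $\mathcal K=\mathbb C^{|\mathcal E|}\oplus\mathbb C^{|\mathcal I|}\oplus\mathbb C^{|\mathcal I|}$ and $d=\dim\mathcal K=|\mathcal E|+2|\mathcal I|$. Let $\mathcal D\subset\mathcal H$ be the set of $\psi=(\psi_j)_j$ such that $\psi_j,\psi_j'$ are (locally) absolutely continuous on $I_j$ and $\psi_j''\in L^2(I_j)$ for every edge $j$, and for $\psi\in\mathcal D$ put $$\underline\psi=\big(\{\psi_e(0)\}_{e\in\mathcal E},\{\psi_i(0)\}_{i\in\mathcal I},\{\psi_i(a_i)\}_{i\in\mathcal I}\big),\qquad \underline\psi'=\big(\{\psi_e'(0)\}_{e\in\mathcal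 E},\{\psi_i'(0)\}_{i\in\mathcal I},\{-\psi_i'(a_i)\}_{i\in\mathcal I}\big).$$ For linear maps $A,B\colon\mathcal K\to\mathcal K$ let $\Delta(A,B)$ be the operator in $\mathcal H$ with domain $\{\psi\in\mathcal D : A\underline\psi+B\underline\psi'=0\}$ acting as $(\Delta(A,B)\psi)_j=\psi_j''$. The boundary conditions defined by $A,B$ are called regular if $\mathcal M(A,B)=\{(\chi_1,\chi_2)\in\mathcal K\oplus\mathcal K : A\chi_1+B\chi_2=0\}$ has dimension $d$ and $A+ikB$ is invertible for some $k\in\mathbb C$. The residual spectrum $\sigma_{\mathrm r}(T)$ of an operator $T$ in $\mathcal H$ is the set of $\lambda\in\mathbb C$ such that $T-\lambda$ is injective and the range of $T-\lambda$ is not dense in $\mathcal H$. **Proposition.** Let $A,B$ define regular boundary conditions. Then the residual spectrum $\sigma_{\mathrm r}(-\Delta(A,B))$ is contained in $[0,\infty)$. If $\mathcal E=\emptyset$ or $\mathcal I=\emptyset$, then $\sigma_{\mathrm r}(-\Delta(A,B))=\emptyset$. -/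

import Mathlib

open MeasureTheory

noncomputable section

/-- A metric graph with vertices `V`, external edges `E` and internal edges `I`: an external edge
`e` is a half-line `[0, ∞)` attached to the vertex `vertex e` at `0`; an internal edge `i` is an
interval `[0, length i]` running from `initial i` to `terminal i`.
The graph is finite if `V`, `E` and `I` are finite. -/
structure MetricGraph (V E I : Type*) where
  vertex : E → V
  initial : I → V
  terminal : I → V
  length : I → ℝ
  length_pos : ∀ i, 0 < length i

/-- `HasSecondDeriv s u u' w`, for an interval `s` with left endpoint `0`: the function `u` is
differentiable on `s` with derivative `u'` (one-sided at endpoints), both `u` and `u'` are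
absolutely continuous on the compact intervals `[0, b] ⊆ s`, and `u'' = w` a.e. on `s`. -/
structure HasSecondDeriv (s : Set ℝ) (u u' w : ℝ → ℂ) : Prop where
  hasDeriv : ∀ x ∈ s, HasDerivWithinAt u (u' x) s x
  ac : ∀ b ∈ s, AbsolutelyContinuousOnInterval u 0 b
  ac_deriv : ∀ b ∈ s, AbsolutelyContinuousOnInterval u' 0 b
  hasDeriv_deriv : ∀ᵐ x ∂(volume.restrict s), HasDerivAt u' (w x) x

theorem HasSecondDeriv.congr {s : Set ℝ} {u u' w w₁ : ℝ → ℂ}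
    (h : HasSecondDeriv s u u' w) (hw : w₁ =ᵐ[volume.restrict s] w) :
    HasSecondDeriv s u u' w₁ where
  hasDeriv := h.hasDeriv
  ac := h.ac
  ac_deriv := h.ac_deriv
  hasDeriv_deriv := by
    filter_upwards [h.hasDeriv_deriv, hw] with x hx hx'
    rwa [hx']

theorem HasSecondDeriv.zero (s : Set ℝ) :
    HasSecondDeriv s (fun _ => 0) (fun _ => 0) (fun _ => 0) where
  hasDeriv x _ := hasDerivWithinAt_const x s 0
  ac _ _ := (contDiffOn_const (n := 1)).absolutelyContinuousOnInterval
  ac_deriv _ _ := (contDiffOn_const (n := 1)).absolutelyContinuousOnInterval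
  hasDeriv_deriv := Filter.Eventually.of_forall fun x => hasDerivAt_const x 0

theorem HasSecondDeriv.add {s : Set ℝ} {u u' w v v' z : ℝ → ℂ}
    (h : HasSecondDeriv s u u' w) (k : HasSecondDeriv s v v' z) :
    HasSecondDeriv s (u + v) (u' + v') (w + z) where
  hasDeriv x hx := (h.hasDeriv x hx).add (k.hasDeriv x hx)
  ac b hb := (h.ac b hb).add (k.ac b hb)
  ac_deriv b hb := (h.ac_deriv b hb).add (k.ac_deriv b hb)
  hasDeriv_deriv := by
    filter_upwards [h.hasDeriv_deriv, k.hasDeriv_deriv] with x hx hx'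
    exact hx.add hx'

theorem HasSecondDeriv.smul {s : Set ℝ} {u u' w : ℝ → ℂ} (c : ℂ)
    (h : HasSecondDeriv s u u' w) :
    HasSecondDeriv s (c • u) (c • u') (c • w) where
  hasDeriv x hx := (h.hasDeriv x hx).const_smul c
  ac b hb := (h.ac b hb).const_smul c
  ac_deriv b hb := (h.ac_deriv b hb).const_smul c
  hasDeriv_deriv := by
    filter_upwards [h.hasDeriv_deriv] with x hx
    exact hx.const_smul c

/-- If `u` vanishes a.e. on `s` then so does `u''`. -/
theorem HasSecondDeriv.ae_eq_zero {s : Set ℝ} (hs : Convex ℝ s)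
    (hms : MeasurableSet s) {u u' w : ℝ → ℂ} (h : HasSecondDeriv s u u' w)
    (hu : u =ᵐ[volume.restrict s] 0) : w =ᵐ[volume.restrict s] 0 := by
  have hnull : volume (frontier s) = 0 := hs.addHaar_frontier volume
  have hu0 : ∀ x ∈ interior s, u x = 0 := by
    have hcont : ContinuousOn u (interior s) := fun x hx =>
      (h.hasDeriv x (interior_subset hx)).continuousWithinAt.mono interior_subset
    have hae : u =ᵐ[volume.restrict (interior s)] fun _ => 0 :=
      ae_restrict_of_ae_restrict_of_subset interior_subset hu
    exact Measure.eqOn_open_of_ae_eq hae isOpen_interior hcont continuousOn_const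
  have hu' : ∀ x ∈ interior s, u' x = 0 := by
    intro x hx
    have h1 : HasDerivAt u (u' x) x :=
      (h.hasDeriv x (interior_subset hx)).hasDerivAt (mem_interior_iff_mem_nhds.mp hx)
    have h2 : HasDerivAt u 0 x :=
      (hasDerivAt_const x (0 : ℂ)).congr_of_eventuallyEq <| by
        filter_upwards [isOpen_interior.mem_nhds hx] with y hy using hu0 y hy
    exact h1.unique h2
  have hint : ∀ᵐ x ∂(volume.restrict s), x ∈ interior s := by
    rw [ae_restrict_iff' hms]
    have : ∀ᵐ x ∂(volume : Measure ℝ), x ∉ frontier s := measure_eq_zero_iff_ae_notMem.mp hnull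
    filter_upwards [this] with x hx hxs
    by_contra hxi
    exact hx ⟨subset_closure hxs, hxi⟩
  filter_upwards [hint, h.hasDeriv_deriv] with x hx hd
  have h2 : HasDerivAt u' 0 x :=
    (hasDerivAt_const x (0 : ℂ)).congr_of_eventuallyEq <| by
      filter_upwards [isOpen_interior.mem_nhds hx] with y hy using hu' y hy
  exact hd.unique h2

namespace MetricGraph

variable {V E I : Type*} (G : MetricGraph V E I)

/-- The interval associated with an edge. -/
def edge : E ⊕ I → Set ℝ :=
  Sum.elim (fun _ => Set.Ici 0) (fun i => Set.Icc 0 (G.length i))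

/-- The Hilbert space `L²` of the metric graph, the Hilbert sum of the `L²` spaces of the edges. -/
abbrev L2 [Fintype E] [Fintype I] : Type _ :=
  PiLp 2 fun j : E ⊕ I => Lp ℂ 2 (volume.restrict (G.edge j))

/-- The space `ℂ^E ⊕ ℂ^I ⊕ ℂ^I` of boundary values (at the endpoints of the external edges, the
initial endpoints and the terminal endpoints of the internal edges). -/
abbrev BoundarySpace (E I : Type*) : Type _ := E ⊕ I ⊕ I → ℂ

/-- The vector of boundary values of a function. -/
def boundaryValue (u : E ⊕ I → ℝ → ℂ) : BoundarySpace E I :=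
  Sum.elim (fun e => u (.inl e) 0)
    (Sum.elim (fun i => u (.inr i) 0) (fun i => u (.inr i) (G.length i)))

/-- The vector of inward boundary derivatives of a function with derivative `u'`. -/
def boundaryDeriv (u' : E ⊕ I → ℝ → ℂ) : BoundarySpace E I :=
  Sum.elim (fun e => u' (.inl e) 0)
    (Sum.elim (fun i => u' (.inr i) 0) (fun i => -u' (.inr i) (G.length i)))

/-- The subspace `M(A, B) = ker (A, B)` of `K ⊕ K`, where `K` is the space of boundary values. -/
def boundarySubspace (A B : BoundarySpace E I →ₗ[ℂ] BoundarySpace E I) :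
    Submodule ℂ (BoundarySpace E I × BoundarySpace E I) :=
  LinearMap.ker (A.coprod B)

/-- Regular boundary conditions: `M(A, B)` has dimension `d = |E| + 2 |I|` and `A + i k B` is
invertible for some complex `k`. -/
def IsRegular [Fintype E] [Fintype I]
    (A B : BoundarySpace E I →ₗ[ℂ] BoundarySpace E I) : Prop :=
  Module.finrank ℂ (boundarySubspace A B) = Fintype.card E + 2 * Fintype.card I ∧
    ∃ k : ℂ, Function.Bijective (A + (Complex.I * k) • B)

/-- The graph of the operator `Δ(A, B)`: the pairs `(ψ, ψ'')` such that on every edge `ψ` and `ψ'`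
are absolutely continuous (for suitable representatives), `ψ, ψ'' ∈ L²`, and the boundary condition
`A ψ + B ψ' = 0` holds for the boundary values of `ψ` and `ψ'`. -/
def laplacianGraph [Fintype E] [Fintype I]
    (A B : BoundarySpace E I →ₗ[ℂ] BoundarySpace E I) :
    Submodule ℂ (G.L2 × G.L2) where
  carrier := {p | ∃ u u' : E ⊕ I → ℝ → ℂ,
    (∀ j, (p.1 j : ℝ → ℂ) =ᵐ[volume.restrict (G.edge j)] u j) ∧
    (∀ j, HasSecondDeriv (G.edge j) (u j) (u' j) (p.2 j)) ∧
    A (G.boundaryValue u) + B (G.boundaryDeriv u') = 0}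
  zero_mem' := by
    refine ⟨fun _ _ => 0, fun _ _ => 0, fun j => Lp.coeFn_zero _ _ _,
      fun j => (HasSecondDeriv.zero _).congr (Lp.coeFn_zero _ _ _), ?_⟩
    have h1 : G.boundaryValue (fun _ _ => 0) = 0 := by
      ext (e | i | i) <;> rfl
    have h2 : G.boundaryDeriv (fun _ _ => 0) = 0 := by
      ext (e | i | i) <;> simp [boundaryDeriv]
    rw [h1, h2, map_zero, map_zero, add_zero]
  add_mem' := by
    rintro p q ⟨u, u', hu, hD, hbc⟩ ⟨v, v', hv, hE, hbc'⟩
    refine ⟨u + v, u' + v', fun j => ?_, fun j => ?_, ?_⟩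
    · exact (Lp.coeFn_add (p.1 j) (q.1 j)).trans ((hu j).add (hv j))
    · exact ((hD j).add (hE j)).congr (Lp.coeFn_add (p.2 j) (q.2 j))
    · have h1 : G.boundaryValue (u + v) = G.boundaryValue u + G.boundaryValue v := by
        ext (e | i | i) <;> rfl
      have h2 : G.boundaryDeriv (u' + v') = G.boundaryDeriv u' + G.boundaryDeriv v' := by
        ext (e | i | i) <;> simp [boundaryDeriv, add_comm]
      rw [h1, h2, map_add, map_add, add_add_add_comm, hbc, hbc', add_zero]
  smul_mem' := by
    rintro c p ⟨u, u', hu, hD, hbc⟩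
    refine ⟨c • u, c • u', fun j => ?_, fun j => ?_, ?_⟩
    · exact (Lp.coeFn_smul c (p.1 j)).trans ((hu j).const_smul c)
    · exact ((hD j).smul c).congr (Lp.coeFn_smul c (p.2 j))
    · have h1 : G.boundaryValue (c • u) = c • G.boundaryValue u := by
        ext (e | i | i) <;> rfl
      have h2 : G.boundaryDeriv (c • u') = c • G.boundaryDeriv u' := by
        ext (e | i | i) <;> simp [boundaryDeriv]
      rw [h1, h2, map_smul, map_smul, ← smul_add, hbc, smul_zero]

/-- `laplacianGraph` is the graph of a function. -/
theorem laplacianGraph_functional [Fintype E] [Fintype I]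
    (A B : BoundarySpace E I →ₗ[ℂ] BoundarySpace E I)
    (p : G.L2 × G.L2) (hp : p ∈ G.laplacianGraph A B) (h0 : p.1 = 0) : p.2 = 0 := by
  obtain ⟨u, u', hu, hD, -⟩ := hp
  ext1 j
  have hj : u j =ᵐ[volume.restrict (G.edge j)] 0 := by
    refine (hu j).symm.trans ?_
    rw [h0]
    exact Lp.coeFn_zero _ _ _
  refine Lp.ext (((hD j).ae_eq_zero ?_ ?_ hj).trans (Lp.coeFn_zero _ _ _).symm)
  · rcases j with e | i
    · exact convex_Ici 0
    · exact convex_Icc 0 _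
  · rcases j with e | i
    · exact measurableSet_Ici
    · exact measurableSet_Icc

/-- The operator `Δ(A, B)` in `L²` of the graph. -/
def laplacian [Fintype E] [Fintype I]
    (A B : BoundarySpace E I →ₗ[ℂ] BoundarySpace E I) : G.L2 →ₗ.[ℂ] G.L2 :=
  (G.laplacianGraph A B).toLinearPMap

theorem graph_laplacian [Fintype E] [Fintype I]
    (A B : BoundarySpace E I →ₗ[ℂ] BoundarySpace E I) :
    (G.laplacian A B).graph = G.laplacianGraph A B :=
  Submodule.toLinearPMap_graph_eq _ (G.laplacianGraph_functional A B)

end MetricGraph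

namespace LinearPMap

variable {H : Type*} [NormedAddCommGroup H] [InnerProductSpace ℂ H]

/-- The point spectrum: the set of eigenvalues. -/
def pointSpectrum (T : H →ₗ.[ℂ] H) : Set ℂ :=
  {z | ∃ x : T.domain, x ≠ 0 ∧ T x = z • (x : H)}

/-- The residual spectrum: the `z` for which `T - z` is injective but its range is not dense. -/
def residualSpectrum (T : H →ₗ.[ℂ] H) : Set ℂ :=
  {z | z ∉ T.pointSpectrum ∧ ¬ DenseRange fun x : T.domain => T x - z • (x : H)}

end LinearPMap

end

/-! Let z be a non-eigenvalue of -Δ(A,B), and write κ² = -z. If Re κ < 0, the square integrable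
solutions of u'' = κ²u form a space of dimension 1 on each half-line (multiples of exp(κx)) and 2 on
each interval, hence of dimension d in total. Their boundary data fill a d-dimensional subspace of K
⊕ K, which meets M(A,B) only in 0 because z is not an eigenvalue
(`disjoint_boundarySubspace_range`). As dim M(A,B) = d, the two subspaces are complementary. A
particular solution for a source of bounded support can therefore be corrected by a homogeneous one
to satisfy the boundary conditions (`exists_domain_of_notMem_pointSpectrum`), so the range of
-Δ(A,B) - z is dense. A root with Re κ < 0 exists exactly when z is not in [0,∞); without external
edges no decay is needed and any root will do.

If there are only half-lines and z = k² ≥ 0, take φ orthogonal to the range. A compactly supported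
source on one edge, orthogonal to both fundamental solutions there, has a solution of bounded
support with zero Cauchy data at 0, which meets every boundary condition. Hence conj φ annihilates
all such sources, so it is a combination of the fundamental solutions
(`ae_eq_of_forall_integral_eq_zero`). No nonzero combination is square integrable
(`eq_zero_of_memLp_fund`), so φ = 0. -/

noncomputable section

namespace MetricGraph

/-! ### Fundamental solutions of u'' = κ²u, including κ = 0 -/

/-- The solution of `u'' = κ² u` with `u 0 = 1`, `u' 0 = 0`. -/
def fundCos (κ : ℂ) (x : ℝ) : ℂ := Complex.cosh (κ * x)

/-- The solution of `u'' = κ² u` with `u 0 = 0`, `u' 0 = 1`. -/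
def fundSin (κ : ℂ) (x : ℝ) : ℂ := if κ = 0 then (x : ℂ) else Complex.sinh (κ * x) / κ

@[simp] theorem fundCos_zero_right (κ : ℂ) : fundCos κ 0 = 1 := by simp [fundCos]

@[simp] theorem fundSin_zero_right (κ : ℂ) : fundSin κ 0 = 0 := by simp [fundSin]

theorem mul_fundSin (κ : ℂ) (x : ℝ) : κ * fundSin κ x = Complex.sinh (κ * x) := by
  by_cases h : κ = 0
  · simp [h]
  · rw [fundSin, if_neg h]; field_simp

theorem hasDerivAt_mul_ofReal (κ : ℂ) (x : ℝ) : HasDerivAt (fun y : ℝ => κ * (y : ℂ)) κ x := by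
  simpa using (Complex.ofRealCLM.hasDerivAt (x := x)).const_mul κ

theorem hasDerivAt_fundCos (κ : ℂ) (x : ℝ) :
    HasDerivAt (fundCos κ) (κ ^ 2 * fundSin κ x) x := by
  have h : HasDerivAt (fundCos κ) (Complex.sinh (κ * x) * κ) x :=
    (Complex.hasDerivAt_cosh (κ * x)).comp x (hasDerivAt_mul_ofReal κ x)
  convert h using 1
  rw [← mul_fundSin]; ring

theorem hasDerivAt_fundSin (κ : ℂ) (x : ℝ) : HasDerivAt (fundSin κ) (fundCos κ x) x := by
  by_cases h : κ = 0
  · have h1 : fundSin κ = fun y : ℝ => (y : ℂ) := by ext y; simp [fundSin, h]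
    rw [h1]
    simpa [fundCos, h] using hasDerivAt_mul_ofReal 1 x
  · have h1 : fundSin κ = fun y : ℝ => Complex.sinh (κ * y) / κ := by ext y; simp [fundSin, h]
    have h2 := ((Complex.hasDerivAt_sinh (κ * x)).comp x (hasDerivAt_mul_ofReal κ x)).div_const κ
    rw [h1]
    simpa [fundCos, h] using h2

theorem continuous_fundCos (κ : ℂ) : Continuous (fundCos κ) :=
  continuous_iff_continuousAt.2 fun x => (hasDerivAt_fundCos κ x).continuousAt

theorem continuous_fundSin (κ : ℂ) : Continuous (fundSin κ) :=
  continuous_iff_continuousAt.2 fun x => (hasDerivAt_fundSin κ x).continuousAt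

/-- The Wronskian of the fundamental pair; it makes variation of constants reproduce exactly the
source f. -/
theorem fundCos_sq_sub (κ : ℂ) (x : ℝ) : fundCos κ x ^ 2 - κ ^ 2 * fundSin κ x ^ 2 = 1 := by
  rw [← mul_pow, mul_fundSin, fundCos, Complex.cosh_sq_sub_sinh_sq]

theorem fundCos_add_mul_fundSin (κ : ℂ) (x : ℝ) :
    fundCos κ x + κ * fundSin κ x = Complex.exp (κ * x) := by
  rw [mul_fundSin, fundCos, Complex.cosh_add_sinh]

/-! ### Variation of constants -/

/-- The solution of `u'' = κ² u + f` which is the sum of `p fundCos + q fundSin` and the solution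
with zero Cauchy data at `b`. -/
def sol (κ : ℂ) (f : ℝ → ℂ) (b : ℝ) (p q : ℂ) (x : ℝ) : ℂ :=
  fundSin κ x * (q + ∫ t in b..x, fundCos κ t * f t) +
    fundCos κ x * (p - ∫ t in b..x, fundSin κ t * f t)

/-- The derivative of `sol`. -/
def solDeriv (κ : ℂ) (f : ℝ → ℂ) (b : ℝ) (p q : ℂ) (x : ℝ) : ℂ :=
  fundCos κ x * (q + ∫ t in b..x, fundCos κ t * f t) +
    κ ^ 2 * fundSin κ x * (p - ∫ t in b..x, fundSin κ t * f t)

theorem hasDerivAt_integral_fundCos {κ : ℂ} {f : ℝ → ℂ} (hf : Continuous f) (b : ℝ) (q : ℂ) (x : ℝ)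
    :
    HasDerivAt (fun y => q + ∫ t in b..y, fundCos κ t * f t) (fundCos κ x * f x) x :=
  (((continuous_fundCos κ).mul hf).integral_hasStrictDerivAt b x).hasDerivAt.const_add q

theorem hasDerivAt_integral_fundSin {κ : ℂ} {f : ℝ → ℂ} (hf : Continuous f) (b : ℝ) (p : ℂ) (x : ℝ)
    :
    HasDerivAt (fun y => p - ∫ t in b..y, fundSin κ t * f t) (-(fundSin κ x * f x)) x :=
  (((continuous_fundSin κ).mul hf).integral_hasStrictDerivAt b x).hasDerivAt.const_sub p

theorem hasDerivAt_sol {κ : ℂ} {f : ℝ → ℂ} (hf : Continuous f) (b : ℝ) (p q : ℂ) (x : ℝ)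
    : HasDerivAt (sol κ f b p q) (solDeriv κ f b p q x) x := by
  refine (((hasDerivAt_fundSin κ x).mul (hasDerivAt_integral_fundCos hf b q x)).add
    ((hasDerivAt_fundCos κ x).mul (hasDerivAt_integral_fundSin hf b p x))).congr_deriv ?_
  rw [solDeriv]; ring

theorem hasDerivAt_solDeriv {κ : ℂ} {f : ℝ → ℂ} (hf : Continuous f) (b : ℝ) (p q : ℂ) (x : ℝ)
    :
    HasDerivAt (solDeriv κ f b p q) (κ ^ 2 * sol κ f b p q x + f x) x := by
  refine (((hasDerivAt_fundCos κ x).mul (hasDerivAt_integral_fundCos hf b q x)).add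
    (((hasDerivAt_fundSin κ x).const_mul (κ ^ 2)).mul
      (hasDerivAt_integral_fundSin hf b p x))).congr_deriv ?_
  rw [sol]
  linear_combination f x * fundCos_sq_sub κ x

theorem continuous_sol {κ : ℂ} {f : ℝ → ℂ} (hf : Continuous f) (b : ℝ) (p q : ℂ)
    : Continuous (sol κ f b p q) :=
  continuous_iff_continuousAt.2 fun x => (hasDerivAt_sol hf b p q x).continuousAt

theorem continuous_solDeriv {κ : ℂ} {f : ℝ → ℂ} (hf : Continuous f) (b : ℝ) (p q : ℂ)
    : Continuous (solDeriv κ f b p q) :=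
  continuous_iff_continuousAt.2 fun x => (hasDerivAt_solDeriv hf b p q x).continuousAt

theorem hasSecondDeriv_sol {κ : ℂ} {f : ℝ → ℂ} (hf : Continuous f) (b : ℝ) (p q : ℂ)
    (s : Set ℝ) :
    HasSecondDeriv s (sol κ f b p q) (solDeriv κ f b p q)
      (fun x => κ ^ 2 * sol κ f b p q x + f x) := by
  have h1 : ContDiff ℝ 1 (sol κ f b p q) := by
    rw [contDiff_one_iff_deriv]
    refine ⟨fun x => (hasDerivAt_sol hf b p q x).differentiableAt, ?_⟩
    rw [show deriv (sol κ f b p q) = _ from funext fun x => (hasDerivAt_sol hf b p q x).deriv]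
    exact continuous_solDeriv hf b p q
  have h2 : ContDiff ℝ 1 (solDeriv κ f b p q) := by
    rw [contDiff_one_iff_deriv]
    refine ⟨fun x => (hasDerivAt_solDeriv hf b p q x).differentiableAt, ?_⟩
    rw [show deriv (solDeriv κ f b p q) = _ from
      funext fun x => (hasDerivAt_solDeriv hf b p q x).deriv]
    exact ((continuous_sol hf b p q).const_mul _).add hf
  exact ⟨fun x _ => (hasDerivAt_sol hf b p q x).hasDerivWithinAt,
    fun _ _ => h1.contDiffOn.absolutelyContinuousOnInterval,
    fun _ _ => h2.contDiffOn.absolutelyContinuousOnInterval,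
    Filter.Eventually.of_forall fun x => hasDerivAt_solDeriv hf b p q x⟩

theorem sol_eq_add (κ : ℂ) (f : ℝ → ℂ) (b : ℝ) (p q : ℂ) (x : ℝ) :
    sol κ f b p q x = p * fundCos κ x + q * fundSin κ x + sol κ f b 0 0 x := by
  simp only [sol]; ring

theorem solDeriv_eq_add (κ : ℂ) (f : ℝ → ℂ) (b : ℝ) (p q : ℂ) (x : ℝ) :
    solDeriv κ f b p q x =
      p * (κ ^ 2 * fundSin κ x) + q * fundCos κ x + solDeriv κ f b 0 0 x := by
  simp only [solDeriv]; ring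

/-- Basing the integrals at b rather than at 0 makes them vanish to the right of the source, so the
behaviour at infinity is governed by p and q alone. -/
theorem sol_eq_of_le {κ : ℂ} {f : ℝ → ℂ} {b : ℝ} (hfb : ∀ x, b ≤ x → f x = 0) (p q : ℂ) {x : ℝ}
    (hx : b ≤ x) : sol κ f b p q x = p * fundCos κ x + q * fundSin κ x := by
  have h : ∀ g : ℝ → ℂ, ∫ t in b..x, g t * f t = 0 := fun g => by
    refine intervalIntegral.integral_zero_ae (Filter.Eventually.of_forall fun t ht => ?_)
    rw [Set.uIoc_of_le hx] at ht
    rw [hfb t ht.1.le, mul_zero]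
  rw [sol, h, h]; ring

/-! ### Square integrability and uniqueness on one edge -/

theorem memLp_Icc_of_continuous {f : ℝ → ℂ} (hf : Continuous f) (a b : ℝ) :
    MemLp f 2 (volume.restrict (Set.Icc a b)) := by
  rw [memLp_two_iff_integrable_sq_norm hf.aestronglyMeasurable]
  exact (hf.norm.pow 2).continuousOn.integrableOn_Icc

/-- A continuous function vanishing on `[b, ∞)` is square integrable on `[0, ∞)`. -/
theorem memLp_Ici_of_eq_zero {f : ℝ → ℂ} (hf : Continuous f) {b : ℝ}
    (hfb : ∀ x, b ≤ x → f x = 0) : MemLp f 2 (volume.restrict (Set.Ici 0)) := by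
  have h1 : MemLp f 2 (volume.restrict (Set.Icc 0 b)) := memLp_Icc_of_continuous hf 0 b
  have h2 : MemLp ((Set.Icc 0 b).indicator f) 2 volume :=
    (memLp_indicator_iff_restrict measurableSet_Icc).2 h1
  refine (memLp_congr_ae ?_).1 (h2.restrict (Set.Ici 0))
  filter_upwards [ae_restrict_mem measurableSet_Ici] with x hx
  by_cases hxb : x ≤ b
  · exact Set.indicator_of_mem (Set.mem_Icc.2 ⟨hx, hxb⟩) f
  · rw [Set.indicator_of_notMem (fun h => hxb h.2), hfb x (not_le.1 hxb).le]

theorem memLp_exp {κ : ℂ} (hκ : κ.re < 0) :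
    MemLp (fun x : ℝ => Complex.exp (κ * x)) 2 (volume.restrict (Set.Ici 0)) := by
  have hc : Continuous fun x : ℝ => Complex.exp (κ * x) := by fun_prop
  rw [memLp_two_iff_integrable_sq_norm hc.aestronglyMeasurable]
  have h := integrableOn_exp_mul_Ioi (a := 2 * κ.re) (by linarith) 0
  rw [← integrableOn_Ici_iff_integrableOn_Ioi] at h
  refine h.congr_fun (fun x _ => ?_) measurableSet_Ici
  rw [Complex.norm_exp, ← Real.exp_nat_mul]
  simp; ring

/-- With q = κp the homogeneous part is p exp(κx), which decays when Re κ < 0; the remaining part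
vanishes beyond b. The alternative p = q = 0 needs no condition on κ and serves the case of real k.
-/
theorem memLp_sol_Ici {κ : ℂ} {f : ℝ → ℂ} (hf : Continuous f) {b : ℝ}
    (hfb : ∀ x, b ≤ x → f x = 0) {p q : ℂ}
    (hpq : p = 0 ∧ q = 0 ∨ κ.re < 0 ∧ q = κ * p) :
    MemLp (sol κ f b p q) 2 (volume.restrict (Set.Ici 0)) := by
  have h0 : MemLp (sol κ f b 0 0) 2 (volume.restrict (Set.Ici 0)) :=
    memLp_Ici_of_eq_zero (continuous_sol hf b 0 0) fun x hx => by
      rw [sol_eq_of_le hfb 0 0 hx]; simp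
  rcases hpq with ⟨rfl, rfl⟩ | ⟨hκ, rfl⟩
  · exact h0
  · have h := ((memLp_exp hκ).const_mul p).add h0
    convert h using 1
    ext x
    rw [Pi.add_apply, sol_eq_add, ← fundCos_add_mul_fundSin]; ring

/-- By continuity the combination vanishes on the closed interval, and p and q are its value and
one-sided derivative at 0. -/
theorem eq_zero_of_fund_ae_eq_zero {κ : ℂ} {a : ℝ} (ha : 0 < a) {p q : ℂ}
    (h : ∀ᵐ x ∂(volume.restrict (Set.Ioo 0 a)), p * fundCos κ x + q * fundSin κ x = 0) :
    p = 0 ∧ q = 0 := by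
  set u : ℝ → ℂ := fun x => p * fundCos κ x + q * fundSin κ x with hu
  have hd : ∀ x, HasDerivAt u (p * (κ ^ 2 * fundSin κ x) + q * fundCos κ x) x := fun x =>
    ((hasDerivAt_fundCos κ x).const_mul p).add ((hasDerivAt_fundSin κ x).const_mul q)
  have hc : Continuous u := continuous_iff_continuousAt.2 fun x => (hd x).continuousAt
  have h1 : Set.EqOn u (fun _ => 0) (Set.Icc 0 a) := by
    have := Measure.eqOn_open_of_ae_eq (f := u) (g := fun _ => 0) h isOpen_Ioo hc.continuousOn
      continuousOn_const
    rw [← closure_Ioo ha.ne]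
    exact this.closure hc continuous_const
  have h2 : HasDerivWithinAt u 0 (Set.Icc 0 a) 0 :=
    (hasDerivWithinAt_const 0 _ (0 : ℂ)).congr h1 (h1 ⟨le_rfl, ha.le⟩)
  have h3 := (uniqueDiffOn_Icc ha 0 ⟨le_rfl, ha.le⟩).eq_deriv _ (hd 0).hasDerivWithinAt h2
  have h4 : u 0 = 0 := h1 ⟨le_rfl, ha.le⟩
  exact ⟨by simpa [hu] using h4, by simpa using h3⟩

/-! ### Boundary data of solutions and solvability of the inhomogeneous equation -/

variable {V E I : Type*} (G : MetricGraph V E I)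

/-- The boundary values and derivatives of the square integrable solutions of `u'' = κ² u`,
for `Re κ < 0`. -/
def solBoundary (κ : ℂ) :
    BoundarySpace E I →ₗ[ℂ] BoundarySpace E I × BoundarySpace E I where
  toFun c := (Sum.elim (fun e => c (.inl e)) (Sum.elim (fun i => c (.inr (.inl i)))
      (fun i => c (.inr (.inl i)) * fundCos κ (G.length i) +
        c (.inr (.inr i)) * fundSin κ (G.length i))),
    Sum.elim (fun e => κ * c (.inl e)) (Sum.elim (fun i => c (.inr (.inr i)))
      (fun i => -(c (.inr (.inl i)) * (κ ^ 2 * fundSin κ (G.length i)) +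
        c (.inr (.inr i)) * fundCos κ (G.length i)))))
  map_add' c d := by
    ext (e | i | i) <;> simp <;> ring
  map_smul' r c := by
    ext (e | i | i) <;> simp <;> ring

/-- The parameters themselves occur among the boundary data, as values and derivatives at 0. -/
theorem solBoundary_injective (κ : ℂ) : Function.Injective (G.solBoundary κ) := by
  intro c d h
  have h1 := congrArg Prod.fst h
  have h2 := congrArg Prod.snd h
  ext (e | i | i)
  · exact congrFun h1 (.inl e)
  · exact congrFun h1 (.inr (.inl i))
  · exact congrFun h2 (.inr (.inl i))

/-- The value at `0` of the solution on each edge with parameters `c`. -/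
def cauchyValue (c : BoundarySpace E I) : E ⊕ I → ℂ :=
  Sum.elim (fun e => c (.inl e)) (fun i => c (.inr (.inl i)))

/-- The derivative at `0` of the solution on each edge with parameters `c`. -/
def cauchyDeriv (κ : ℂ) (c : BoundarySpace E I) : E ⊕ I → ℂ :=
  Sum.elim (fun e => κ * c (.inl e)) (fun i => c (.inr (.inr i)))

theorem boundaryValue_sol (κ : ℂ) (f : E ⊕ I → ℝ → ℂ) (b : ℝ) (c : BoundarySpace E I) :
    G.boundaryValue (fun j => sol κ (f j) b (cauchyValue c j) (cauchyDeriv κ c j)) =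
      (G.solBoundary κ c).1 + G.boundaryValue fun j => sol κ (f j) b 0 0 := by
  ext (e | i | i)
  all_goals
    simp only [boundaryValue, Sum.elim_inl, Sum.elim_inr, Pi.add_apply, solBoundary,
      LinearMap.coe_mk, AddHom.coe_mk]
    rw [sol_eq_add]
    simp [cauchyValue, cauchyDeriv]

theorem boundaryDeriv_sol (κ : ℂ) (f : E ⊕ I → ℝ → ℂ) (b : ℝ) (c : BoundarySpace E I) :
    G.boundaryDeriv (fun j => solDeriv κ (f j) b (cauchyValue c j) (cauchyDeriv κ c j)) =
      (G.solBoundary κ c).2 + G.boundaryDeriv fun j => solDeriv κ (f j) b 0 0 := by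
  ext (e | i | i)
  all_goals
    simp only [boundaryDeriv, Sum.elim_inl, Sum.elim_inr, Pi.add_apply, solBoundary,
      LinearMap.coe_mk, AddHom.coe_mk]
    rw [solDeriv_eq_add]
    simp [cauchyValue, cauchyDeriv]
  ring

@[simp] theorem sol_zero (κ : ℂ) (b : ℝ) : sol κ 0 b 0 0 = 0 := by
  ext x; simp [sol]

@[simp] theorem solDeriv_zero (κ : ℂ) (b : ℝ) : solDeriv κ 0 b 0 0 = 0 := by
  ext x; simp [solDeriv]

variable [Fintype E] [Fintype I] (A B : BoundarySpace E I →ₗ[ℂ] BoundarySpace E I)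

/-- Solutions of `-u'' - z u = -f` on the edges with admissible boundary values lie in the domain
of `-Δ(A, B)`. -/
theorem exists_domain_of_sol {z κ : ℂ} (hκ : κ ^ 2 = -z) {f : E ⊕ I → ℝ → ℂ}
    (hf : ∀ j, Continuous (f j)) {b : ℝ} (hfb : ∀ j x, b ≤ x → f j x = 0) {p q : E ⊕ I → ℂ}
    (hpq : ∀ e : E, p (.inl e) = 0 ∧ q (.inl e) = 0 ∨
      κ.re < 0 ∧ q (.inl e) = κ * p (.inl e))
    (hbc : A (G.boundaryValue fun j => sol κ (f j) b (p j) (q j)) +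
      B (G.boundaryDeriv fun j => solDeriv κ (f j) b (p j) (q j)) = 0) :
    ∃ x : (-G.laplacian A B).domain,
      (∀ j, ((x : G.L2) j : ℝ → ℂ) =ᵐ[volume.restrict (G.edge j)] sol κ (f j) b (p j) (q j)) ∧
      ∀ j, (((-G.laplacian A B) x - z • (x : G.L2)) j : ℝ → ℂ)
        =ᵐ[volume.restrict (G.edge j)] fun t => -f j t := by
  have hu : ∀ j, MemLp (sol κ (f j) b (p j) (q j)) 2 (volume.restrict (G.edge j)) := by
    rintro (e | i)
    · exact memLp_sol_Ici (hf _) (hfb _) (hpq e)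
    · exact memLp_Icc_of_continuous (continuous_sol (hf _) b _ _) 0 (G.length i)
  have hf2 : ∀ j, MemLp (f j) 2 (volume.restrict (G.edge j)) := by
    rintro (e | i)
    · exact memLp_Ici_of_eq_zero (hf _) (hfb _)
    · exact memLp_Icc_of_continuous (hf _) 0 (G.length i)
  have hw : ∀ j, MemLp (fun t => κ ^ 2 * sol κ (f j) b (p j) (q j) t + f j t) 2
      (volume.restrict (G.edge j)) := fun j => ((hu j).const_mul (κ ^ 2)).add (hf2 j)
  let u : G.L2 := WithLp.toLp 2 fun j => (hu j).toLp
  let w : G.L2 := WithLp.toLp 2 fun j => (hw j).toLp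
  have hmem : (u, w) ∈ (G.laplacian A B).graph := by
    rw [graph_laplacian]
    exact ⟨_, _, fun j => (hu j).coeFn_toLp,
      fun j => (hasSecondDeriv_sol (hf j) b (p j) (q j) _).congr (hw j).coeFn_toLp, hbc⟩
  obtain ⟨x, hx, hxw⟩ := (LinearPMap.mem_graph_iff _).1 hmem
  refine ⟨x, fun j => ?_, fun j => ?_⟩
  · rw [hx]
    exact (hu j).coeFn_toLp
  · have hT : (-G.laplacian A B) x = -w := congrArg Neg.neg hxw
    rw [hT, hx]
    have h1 := Lp.coeFn_sub ((-w) j) ((z • u) j)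
    have h2 := Lp.coeFn_neg (w j)
    have h3 := Lp.coeFn_smul z (u j)
    have h4 : (w j : ℝ → ℂ) =ᵐ[volume.restrict (G.edge j)] _ := (hw j).coeFn_toLp
    have h5 : (u j : ℝ → ℂ) =ᵐ[volume.restrict (G.edge j)] _ := (hu j).coeFn_toLp
    filter_upwards [h1, h2, h3, h4, h5] with t h1 h2 h3 h4 h5
    refine h1.trans ?_
    have h2' : ((-w) j : ℝ → ℂ) t = _ := h2
    have h3' : ((z • u) j : ℝ → ℂ) t = _ := h3
    rw [Pi.sub_apply, h2', h3', Pi.neg_apply, Pi.smul_apply, h4, h5, hκ, smul_eq_mul]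
    ring

/-- A common element consists of the boundary data of a square integrable homogeneous solution lying
in the domain. It would be an eigenfunction for z unless it vanishes, and a vanishing solution has
zero Cauchy data on every edge. -/
theorem disjoint_boundarySubspace_range {z κ : ℂ} (hκ : κ ^ 2 = -z) (hre : IsEmpty E ∨ κ.re < 0)
    (hz : z ∉ (-G.laplacian A B).pointSpectrum) :
    Disjoint (boundarySubspace A B) (LinearMap.range (G.solBoundary κ)) := by
  rw [Submodule.disjoint_def]
  rintro _ hM ⟨c, rfl⟩
  have hM' : A (G.solBoundary κ c).1 + B (G.solBoundary κ c).2 = 0 := hM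
  have hbv : G.boundaryValue (fun _ => 0) = 0 := by
    ext (e | i | i) <;> rfl
  have hbd : G.boundaryDeriv (fun _ => 0) = 0 := by
    ext (e | i | i) <;> simp [boundaryDeriv]
  obtain ⟨x, hx, hTx⟩ := G.exists_domain_of_sol A B (f := fun _ => 0) (b := 0)
    (p := cauchyValue c) (q := cauchyDeriv κ c) hκ (fun _ => continuous_const)
    (fun _ _ _ => rfl) (fun e => hre.elim (fun h => h.elim e) fun h => .inr ⟨h, rfl⟩)
    (by rw [boundaryValue_sol, boundaryDeriv_sol]; simpa [hbv, hbd] using hM')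
  have hx0 : x = 0 := by
    by_contra hne
    refine hz ⟨x, hne, sub_eq_zero.1 ?_⟩
    ext1 j
    refine Lp.ext ((hTx j).trans ?_)
    filter_upwards [Lp.coeFn_zero ℂ 2 (volume.restrict (G.edge j))] with t ht
    simpa using ht.symm
  have hcd : ∀ j, cauchyValue c j = 0 ∧ cauchyDeriv κ c j = 0 := by
    intro j
    obtain ⟨a, ha, hsub⟩ : ∃ a, 0 < a ∧ Set.Ioo 0 a ⊆ G.edge j := by
      rcases j with e | i
      · exact ⟨1, one_pos, fun t ht => ht.1.le⟩
      · exact ⟨G.length i, G.length_pos i, Set.Ioo_subset_Icc_self⟩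
    refine eq_zero_of_fund_ae_eq_zero (κ := κ) ha (ae_restrict_of_ae_restrict_of_subset hsub ?_)
    have h0 : (((0 : (-G.laplacian A B).domain) : G.L2) j : ℝ → ℂ)
        =ᵐ[volume.restrict (G.edge j)] 0 := Lp.coeFn_zero _ _ _
    have h1 := hx j
    rw [hx0] at h1
    filter_upwards [h0, h1] with t h0 h1
    have h2 := sol_eq_add κ 0 0 (cauchyValue c j) (cauchyDeriv κ c j) t
    rw [sol_zero, Pi.zero_apply, add_zero] at h2
    exact h2.symm.trans (h1.symm.trans h0)
  have hc : c = 0 := by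
    ext (e | i | i)
    · exact (hcd (.inl e)).1
    · exact (hcd (.inr i)).1
    · exact (hcd (.inr i)).2
  rw [hc, map_zero]

/-- If `z` is not an eigenvalue and every edge carries as many square integrable solutions of
`-u'' = z u` as it has endpoints, then continuous functions with bounded support are in the range of
`-Δ(A, B) - z`. -/
theorem exists_domain_of_notMem_pointSpectrum
    (hdim : Module.finrank ℂ (boundarySubspace A B) = Fintype.card E + 2 * Fintype.card I)
    {z κ : ℂ} (hκ : κ ^ 2 = -z) (hre : IsEmpty E ∨ κ.re < 0)
    (hz : z ∉ (-G.laplacian A B).pointSpectrum) {f : E ⊕ I → ℝ → ℂ}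
    (hf : ∀ j, Continuous (f j)) {b : ℝ} (hfb : ∀ j x, b ≤ x → f j x = 0) :
    ∃ x : (-G.laplacian A B).domain,
      ∀ j, (((-G.laplacian A B) x - z • (x : G.L2)) j : ℝ → ℂ)
        =ᵐ[volume.restrict (G.edge j)] fun t => -f j t := by
  -- Two disjoint subspaces of dimension d in a space of dimension 2d.
  have htop : boundarySubspace A B ⊔ LinearMap.range (G.solBoundary κ) = ⊤ := by
    refine Submodule.eq_top_of_disjoint _ _ ?_ (G.disjoint_boundarySubspace_range A B hκ hre hz)
    rw [hdim, LinearMap.finrank_range_of_inj (G.solBoundary_injective κ)]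
    simp only [Module.finrank_prod, Module.finrank_fintype_fun_eq_card, Fintype.card_sum]
    omega
  have hmem : ((G.boundaryValue fun j => sol κ (f j) b 0 0),
      (G.boundaryDeriv fun j => solDeriv κ (f j) b 0 0)) ∈
      boundarySubspace A B ⊔ LinearMap.range (G.solBoundary κ) := htop ▸ Submodule.mem_top
  obtain ⟨m, hm, _, ⟨c, rfl⟩, hmc⟩ := Submodule.mem_sup.1 hmem
  have hm' : A m.1 + B m.2 = 0 := hm
  -- The particular solution has boundary data m plus those of the homogeneous solution c;
  -- subtracting the latter leaves m, which lies in M(A,B).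
  obtain ⟨x, -, hx⟩ := G.exists_domain_of_sol A B (f := f) (b := b)
    (p := cauchyValue (-c)) (q := cauchyDeriv κ (-c)) hκ hf hfb
    (fun e => hre.elim (fun h => h.elim e) fun h => .inr ⟨h, rfl⟩) (by
      rw [boundaryValue_sol, boundaryDeriv_sol, map_neg]
      have h1 := congrArg Prod.fst hmc
      have h2 := congrArg Prod.snd hmc
      simp only [Prod.fst_add, Prod.snd_add] at h1 h2
      rw [← h1, ← h2, Prod.fst_neg, Prod.snd_neg, neg_add_cancel_comm_assoc,
        neg_add_cancel_comm_assoc]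
      exact hm')
  exact ⟨x, hx⟩

end MetricGraph

/-! ### Orthogonal vectors and annihilators of test functions -/

theorem LinearPMap.exists_orthogonal_of_not_denseRange {H : Type*} [NormedAddCommGroup H]
    [InnerProductSpace ℂ H] [CompleteSpace H] (T : H →ₗ.[ℂ] H) (z : ℂ)
    (h : ¬ DenseRange fun x : T.domain => T x - z • (x : H)) :
    ∃ φ : H, φ ≠ 0 ∧ ∀ x : T.domain, inner ℂ φ (T x - z • (x : H)) = 0 := by
  set R := LinearMap.range (T.toFun - z • T.domain.subtype)
  by_contra! hφ
  refine h ?_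
  have hR : R.topologicalClosure = ⊤ := by
    rw [Submodule.topologicalClosure_eq_top_iff, Submodule.eq_bot_iff]
    intro φ hφR
    by_contra hne
    obtain ⟨x, hx⟩ := hφ φ hne
    exact hx (Submodule.inner_left_of_mem_orthogonal (LinearMap.mem_range_self _ x) hφR)
  exact Submodule.dense_iff_topologicalClosure_eq_top.2 hR

/-- If a locally integrable function annihilates all continuous compactly supported functions that
are annihilated by `g₁` and `g₂`, then it is a linear combination of `g₁` and `g₂`. -/
theorem ae_eq_of_forall_integral_eq_zero {μ : Measure ℝ} [IsLocallyFiniteMeasure μ]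
    {ψ g₁ g₂ : ℝ → ℂ} (hψ : LocallyIntegrable ψ μ) (hg₁ : Continuous g₁) (hg₂ : Continuous g₂)
    (h : ∀ f : ℝ → ℂ, Continuous f → HasCompactSupport f → ∫ x, f x * g₁ x ∂μ = 0 →
      ∫ x, f x * g₂ x ∂μ = 0 → ∫ x, f x * ψ x ∂μ = 0) :
    ∃ a b : ℂ, ∀ᵐ x ∂μ, ψ x = a * g₁ x + b * g₂ x := by
  have hint : ∀ {g : ℝ → ℂ}, LocallyIntegrable g μ → ∀ {f : ℝ → ℂ}, Continuous f →
      HasCompactSupport f → Integrable (fun x => f x * g x) μ := fun hg _ hf hfc =>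
    hg.integrable_smul_left_of_hasCompactSupport hf hfc
  let L : ∀ g : ℝ → ℂ, LocallyIntegrable g μ → CompactlySupportedContinuousMap ℝ ℂ →ₗ[ℂ] ℂ :=
    fun g hg =>
    { toFun := fun f => ∫ x, f x * g x ∂μ
      map_add' := fun f f' => by
        simp only [CompactlySupportedContinuousMap.add_apply, add_mul]
        exact integral_add (hint hg f.continuous f.hasCompactSupport)
          (hint hg f'.continuous f'.hasCompactSupport)
      map_smul' := fun c f => by
        simp only [CompactlySupportedContinuousMap.smul_apply, smul_eq_mul, mul_assoc,
          RingHom.id_apply]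
        exact integral_const_mul c _ }
  -- Pure linear algebra: a functional vanishing on the common kernel of finitely many functionals
  -- lies in their span.
  have hmem := mem_span_of_iInf_ker_le_ker
    (L := ![L g₁ hg₁.locallyIntegrable, L g₂ hg₂.locallyIntegrable]) (K := L ψ hψ) (by
      intro f hf
      rw [Submodule.mem_iInf] at hf
      exact h f f.continuous f.hasCompactSupport (hf 0) (hf 1))
  rw [Matrix.range_cons, Matrix.range_cons, Matrix.range_empty, Set.union_empty,
    Set.singleton_union, Submodule.mem_span_pair] at hmem
  obtain ⟨a, b, hab⟩ := hmem
  refine ⟨a, b, ?_⟩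
  have hc : Continuous fun x => a * g₁ x + b * g₂ x := by fun_prop
  -- The identity of functionals is now tested only on real smooth functions, which already
  -- determine a locally integrable function almost everywhere.
  have h0 := ae_eq_zero_of_integral_contDiff_smul_eq_zero (hψ.sub hc.locallyIntegrable)
    (fun g hg hgc => by
      let f : CompactlySupportedContinuousMap ℝ ℂ :=
        ⟨⟨fun x => (g x : ℂ), Complex.continuous_ofReal.comp hg.continuous⟩,
          hgc.comp_left Complex.ofReal_zero⟩
      have hf : a * (∫ x, (g x : ℂ) * g₁ x ∂μ) + b * (∫ x, (g x : ℂ) * g₂ x ∂μ) =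
        ∫ x, (g x : ℂ) * ψ x ∂μ := LinearMap.congr_fun hab f
      have i₁ : Integrable (fun x => (g x : ℂ) * g₁ x) μ :=
        hint hg₁.locallyIntegrable f.continuous f.hasCompactSupport
      have i₂ : Integrable (fun x => (g x : ℂ) * g₂ x) μ :=
        hint hg₂.locallyIntegrable f.continuous f.hasCompactSupport
      have i₃ : Integrable (fun x => (g x : ℂ) * ψ x) μ :=
        hint hψ f.continuous f.hasCompactSupport
      calc ∫ x, g x • (ψ - fun x => a * g₁ x + b * g₂ x) x ∂μ
          = ∫ x, ((g x : ℂ) * ψ x - (a * ((g x : ℂ) * g₁ x) + b * ((g x : ℂ) * g₂ x))) ∂μ := by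
            congr 1; ext x; rw [Pi.sub_apply, Complex.real_smul]; ring
        _ = 0 := by
            have i₄ : Integrable (fun x => a * ((g x : ℂ) * g₁ x) + b * ((g x : ℂ) * g₂ x)) μ :=
              (i₁.const_mul a).add (i₂.const_mul b)
            rw [integral_sub i₃ i₄, integral_add (i₁.const_mul a) (i₂.const_mul b), integral_const_mul,
              integral_const_mul, hf, sub_self])
  filter_upwards [h0] with x hx
  exact sub_eq_zero.1 hx

/-! ### No square integrable solutions on a half-line for real k -/

namespace MetricGraph

theorem eq_zero_of_memLp_affine {a b : ℂ}
    (h : MemLp (fun x : ℝ => a + b * x) 2 (volume.restrict (Set.Ici 0))) : a = 0 ∧ b = 0 := by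
  have hc : Continuous fun x : ℝ => a + b * (x : ℂ) := by fun_prop
  have hi : IntegrableOn (fun x : ℝ => ‖a + b * x‖ ^ 2) (Set.Ici 0) :=
    (memLp_two_iff_integrable_sq_norm hc.aestronglyMeasurable).1 h
  -- A square integrable function cannot stay bounded away from 0 on a half-line, which has infinite
  -- measure.
  have key : ∀ ε X : ℝ, 0 < ε → 0 ≤ X → ¬ ∀ x : ℝ, X ≤ x → ε ≤ ‖a + b * x‖ := by
    intro ε X hε hX hle
    have h1 : IntegrableOn (fun _ : ℝ => ε ^ 2) (Set.Ici X) := by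
      refine Integrable.mono' (hi.mono_set (Set.Ici_subset_Ici.2 hX))
        continuous_const.aestronglyMeasurable ?_
      filter_upwards [ae_restrict_mem measurableSet_Ici] with x hx
      rw [Real.norm_of_nonneg (sq_nonneg ε)]
      exact pow_le_pow_left₀ hε.le (hle x hx) 2
    rw [integrableOn_const_iff] at h1
    rcases h1 with h1 | h1
    · exact hε.ne' (by simpa using h1)
    · simp at h1
  have hb : b = 0 := by
    by_contra hb
    have hb' : 0 < ‖b‖ := norm_pos_iff.2 hb
    -- From this point on ‖b x‖ ≥ 1 + ‖a‖, so the affine function has norm at least 1.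
    refine key 1 ((1 + ‖a‖) / ‖b‖) one_pos (by positivity) fun x hx => ?_
    have hx0 : 0 ≤ x := le_trans (by positivity) hx
    have h1 : ‖b * (x : ℂ)‖ - ‖a‖ ≤ ‖a + b * x‖ := by
      have := norm_sub_norm_le (b * (x : ℂ)) (-a)
      rwa [norm_neg, sub_neg_eq_add, add_comm (b * (x : ℂ))] at this
    rw [norm_mul, Complex.norm_real, Real.norm_of_nonneg hx0] at h1
    rw [div_le_iff₀ hb'] at hx
    linarith
  refine ⟨?_, hb⟩
  by_contra ha
  exact key ‖a‖ 0 (norm_pos_iff.2 ha) le_rfl fun x _ => by simp [hb]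

/-- For real `k`, the equation `u'' = -k² u` has no nonzero square integrable solution on
`[0, ∞)`. -/
theorem eq_zero_of_memLp_fund {k : ℝ} (hk : 0 ≤ k) {a b : ℂ}
    (h : MemLp (fun x => a * fundCos (Complex.I * k) x + b * fundSin (Complex.I * k) x) 2
      (volume.restrict (Set.Ici 0))) : a = 0 ∧ b = 0 := by
  rcases hk.eq_or_lt with rfl | hk
  · refine eq_zero_of_memLp_affine ?_
    simpa [fundCos, fundSin] using h
  · have hκ : Complex.I * (k : ℂ) ≠ 0 := by simp [hk.ne']
    set u : ℝ → ℂ := fun x => a * fundCos (Complex.I * k) x + b * fundSin (Complex.I * k) x with hu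
    have hc : Continuous u :=
      ((continuous_fundCos _).const_mul a).add ((continuous_fundSin _).const_mul b)
    have hT : 0 < 2 * Real.pi / k := div_pos Real.two_pi_pos hk
    have hcs : ∀ x : ℝ, Complex.I * (k : ℂ) * ((x + 2 * Real.pi / k : ℝ) : ℂ) =
        Complex.I * k * x + 2 * Real.pi * Complex.I := by
      intro x
      have : (k : ℂ) ≠ 0 := by exact_mod_cast hk.ne'
      push_cast
      field_simp
    have hexp : ∀ w : ℂ, Complex.exp (w + 2 * Real.pi * Complex.I) = Complex.exp w :=
      Complex.exp_periodic
    have hexp' : ∀ w : ℂ, Complex.exp (-(w + 2 * Real.pi * Complex.I)) = Complex.exp (-w) := by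
      intro w
      rw [neg_add, ← sub_eq_add_neg, Complex.exp_periodic.sub_eq]
    have hper : Function.Periodic (fun x => ‖u x‖ ^ 2) (2 * Real.pi / k) := by
      intro x
      simp only [hu, fundCos, fundSin, if_neg hκ, hcs, Complex.cosh, Complex.sinh, hexp, hexp']
    have hi : IntegrableOn (fun x => ‖u x‖ ^ 2) (Set.Ioi 0) :=
      IntegrableOn.mono_set ((memLp_two_iff_integrable_sq_norm hc.aestronglyMeasurable).1 h)
        Set.Ioi_subset_Ici_self
    have hlim := intervalIntegral_tendsto_integral_Ioi 0 hi Filter.tendsto_id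
    -- A positive integral over one period would make the integrals over [0, X] diverge, against the
    -- integrability of ‖u‖².
    have h0 : ∫ x in (0 : ℝ)..(2 * Real.pi / k), ‖u x‖ ^ 2 = 0 := by
      refine le_antisymm (not_lt.1 fun hpos => ?_)
        (intervalIntegral.integral_nonneg hT.le fun x _ => sq_nonneg _)
      exact not_tendsto_nhds_of_tendsto_atTop
        (hper.tendsto_atTop_intervalIntegral_of_pos hpos hT) _ hlim
    rw [intervalIntegral.integral_eq_zero_iff_of_le_of_nonneg_ae hT.le
      (Filter.Eventually.of_forall fun x => sq_nonneg _)
      ((hc.norm.pow 2).intervalIntegrable _ _)] at h0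
    refine eq_zero_of_fund_ae_eq_zero (κ := Complex.I * k) hT
      (ae_restrict_of_ae_restrict_of_subset Set.Ioo_subset_Ioc_self ?_)
    filter_upwards [h0] with x hx
    simpa using hx

theorem exists_forall_le_eq_zero {f : ℝ → ℂ} (hf : HasCompactSupport f) :
    ∃ b, 0 ≤ b ∧ ∀ x, b ≤ x → f x = 0 := by
  obtain ⟨c, hc⟩ := hf.isCompact.bddAbove
  refine ⟨max c 0 + 1, by positivity, fun x hx => image_eq_zero_of_notMem_tsupport fun hx' => ?_⟩
  have h1 : x ≤ c := hc hx'
  have h2 := le_max_left c 0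
  linarith

theorem intervalIntegral_eq_integral_Ici {g : ℝ → ℂ} {b : ℝ} (hb : 0 ≤ b)
    (hg : ∀ x, b ≤ x → g x = 0) : ∫ t in b..0, g t = -∫ t in Set.Ici 0, g t := by
  rw [intervalIntegral.integral_symm, intervalIntegral.integral_of_le hb,
    integral_Ici_eq_integral_Ioi]
  congr 1
  refine (setIntegral_eq_of_subset_of_forall_sdiff_eq_zero measurableSet_Ioi
    Set.Ioc_subset_Ioi_self fun x hx => hg x ?_).symm
  exact (not_le.1 fun h => hx.2 ⟨hx.1, h⟩).le

/-! ### Vectors orthogonal to the range -/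

variable {V E I : Type*} [Fintype E] [Fintype I] (G : MetricGraph V E I)
  (A B : BoundarySpace E I →ₗ[ℂ] BoundarySpace E I)

theorem integral_mul_conj_eq_zero [DecidableEq (E ⊕ I)] {φ y : G.L2} (h : inner ℂ φ y = 0)
    {f : ℝ → ℂ} {j : E ⊕ I}
    (hy : ∀ i, (y i : ℝ → ℂ) =ᵐ[volume.restrict (G.edge i)] fun t =>
      -(Pi.single j f : E ⊕ I → ℝ → ℂ) i t) :
    ∫ t in G.edge j, f t * starRingEnd ℂ (φ j t) = 0 := by
  rw [PiLp.inner_apply, Finset.sum_eq_single j] at h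
  · rw [L2.inner_def] at h
    rw [← neg_eq_zero, ← integral_neg, ← h]
    refine integral_congr_ae ?_
    filter_upwards [hy j] with t ht
    rw [ht, Pi.single_eq_same, RCLike.inner_apply, neg_mul]
  · intro i _ hij
    have h0 : y i = 0 := by
      refine Lp.ext ?_
      filter_upwards [hy i, Lp.coeFn_zero ℂ 2 (volume.restrict (G.edge i))] with t ht h0
      rw [ht, h0, Pi.single_eq_of_ne hij]; simp
    rw [h0, inner_zero_right]
  · exact fun hj => absurd (Finset.mem_univ j) hj

theorem locallyIntegrable_conj (φ : G.L2) (j : E ⊕ I) :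
    LocallyIntegrable (fun t => starRingEnd ℂ (φ j t)) (volume.restrict (G.edge j)) :=
  (Lp.memLp (φ j)).star.locallyIntegrable one_le_two

/-- A vector orthogonal to the range is tested against smooth compactly supported sources on one
edge at a time; all of these lie in the range, so each component vanishes. -/
theorem notMem_residualSpectrum_of_sol
    (hdim : Module.finrank ℂ (boundarySubspace A B) = Fintype.card E + 2 * Fintype.card I)
    {z κ : ℂ} (hκ : κ ^ 2 = -z) (hre : IsEmpty E ∨ κ.re < 0) :
    z ∉ (-G.laplacian A B).residualSpectrum := by
  classical
  rintro ⟨hz, hd⟩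
  obtain ⟨φ, hφ0, hφ⟩ := LinearPMap.exists_orthogonal_of_not_denseRange _ z hd
  refine hφ0 ?_
  ext1 j
  refine Lp.ext ?_
  have h0 := ae_eq_zero_of_integral_contDiff_smul_eq_zero (G.locallyIntegrable_conj φ j)
    (fun g hg hgc => by
      have hgc' : HasCompactSupport fun x => (g x : ℂ) := hgc.comp_left Complex.ofReal_zero
      obtain ⟨b, -, hb⟩ := exists_forall_le_eq_zero hgc'
      obtain ⟨x, hx⟩ := G.exists_domain_of_notMem_pointSpectrum A B hdim hκ hre hz
        (f := Pi.single j fun x => (g x : ℂ)) (b := b) (fun i => by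
          rcases eq_or_ne i j with rfl | hij
          · rw [Pi.single_eq_same]
            exact Complex.continuous_ofReal.comp hg.continuous
          · rw [Pi.single_eq_of_ne hij]
            exact continuous_const) (fun i t ht => by
          rcases eq_or_ne i j with rfl | hij
          · rw [Pi.single_eq_same]
            exact hb t ht
          · rw [Pi.single_eq_of_ne hij]; rfl)
      simpa only [Complex.real_smul] using G.integral_mul_conj_eq_zero (hφ x) hx)
  filter_upwards [h0, Lp.coeFn_zero ℂ 2 (volume.restrict (G.edge j))] with t ht ht0
  exact ((map_eq_zero _).1 ht).trans ht0.symm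

/-- Here the solutions oscillate or are affine, and the dimension count fails. Only sources whose
solutions vanish beyond b and have zero Cauchy data at 0 are used, so A and B play no role in
solving the equation. -/
theorem notMem_residualSpectrum_of_isEmpty [IsEmpty I] {k : ℝ} (hk : 0 ≤ k) :
    ((k ^ 2 : ℝ) : ℂ) ∉ (-G.laplacian A B).residualSpectrum := by
  classical
  rintro ⟨-, hd⟩
  obtain ⟨φ, hφ0, hφ⟩ := LinearPMap.exists_orthogonal_of_not_denseRange _ _ hd
  refine hφ0 ?_
  ext1 j
  refine Lp.ext ?_
  obtain ⟨e, rfl⟩ : ∃ e, j = .inl e := by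
    rcases j with e | i
    · exact ⟨e, rfl⟩
    · exact isEmptyElim i
  have hκ : (Complex.I * (k : ℂ)) ^ 2 = -((k ^ 2 : ℝ) : ℂ) := by
    rw [mul_pow, Complex.I_sq]; push_cast; ring
  obtain ⟨a, b, hab⟩ := ae_eq_of_forall_integral_eq_zero (G.locallyIntegrable_conj φ (.inl e))
    (continuous_fundCos (Complex.I * k)) (continuous_fundSin (Complex.I * k))
    (fun f hf hfc hC hS => by
      obtain ⟨b, hb0, hb⟩ := exists_forall_le_eq_zero hfc
      have hint : ∀ g : ℝ → ℂ, ∫ x in Set.Ici 0, f x * g x = 0 →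
          ∫ x in b..0, g x * f x = 0 := fun g hg => by
        rw [intervalIntegral_eq_integral_Ici hb0 fun x hx => by rw [hb x hx, mul_zero]]
        simp only [mul_comm (g _), hg, neg_zero]
      -- At 0 the value and the derivative of the solution with zero data at b are, up to sign, the
      -- integrals of f against `fundSin` and `fundCos`, which vanish by `hS` and `hC`.
      have hsol : ∀ e', sol (Complex.I * k) ((Pi.single (Sum.inl e) f : E ⊕ I → ℝ → ℂ) (.inl e'))
          b 0 0 0 = 0 ∧ solDeriv (Complex.I * k)
            ((Pi.single (Sum.inl e) f : E ⊕ I → ℝ → ℂ) (.inl e')) b 0 0 0 = 0 := fun e' => by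
        rcases eq_or_ne e' e with rfl | he
        · rw [Pi.single_eq_same]
          simp [sol, solDeriv, hint _ hC, hint _ hS]
        · rw [Pi.single_eq_of_ne (by simpa using he)]
          simp
      obtain ⟨x, -, hx⟩ := G.exists_domain_of_sol A B hκ
        (f := Pi.single (.inl e) f) (b := b) (p := 0) (q := 0) (fun i => by
          rcases eq_or_ne i (.inl e) with rfl | hij
          · rwa [Pi.single_eq_same]
          · rw [Pi.single_eq_of_ne hij]
            exact continuous_const) (fun i t ht => by
          rcases eq_or_ne i (.inl e) with rfl | hij
          · rw [Pi.single_eq_same]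
            exact hb t ht
          · rw [Pi.single_eq_of_ne hij]; rfl) (fun _ => .inl ⟨rfl, rfl⟩) (by
          have h1 : G.boundaryValue (fun j => sol (Complex.I * k)
              ((Pi.single (.inl e) f : E ⊕ I → ℝ → ℂ) j) b
              ((0 : E ⊕ I → ℂ) j) ((0 : E ⊕ I → ℂ) j)) = 0 := by
            ext (e' | i | i)
            · exact (hsol e').1
            · exact isEmptyElim i
            · exact isEmptyElim i
          have h2 : G.boundaryDeriv (fun j => solDeriv (Complex.I * k)
              ((Pi.single (.inl e) f : E ⊕ I → ℝ → ℂ) j) b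
              ((0 : E ⊕ I → ℂ) j) ((0 : E ⊕ I → ℂ) j)) = 0 := by
            ext (e' | i | i)
            · exact (hsol e').2
            · exact isEmptyElim i
            · exact isEmptyElim i
          rw [h1, h2, map_zero, map_zero, add_zero])
      exact G.integral_mul_conj_eq_zero (hφ x) hx)
  have hL := (memLp_congr_ae hab).1 (Lp.memLp (φ (.inl e))).star
  obtain ⟨rfl, rfl⟩ := eq_zero_of_memLp_fund hk hL
  filter_upwards [hab, Lp.coeFn_zero ℂ 2 (volume.restrict (G.edge (.inl e)))] with t ht ht0
  rw [zero_mul, zero_mul, add_zero] at ht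
  exact ((map_eq_zero _).1 ht).trans ht0.symm

end MetricGraph

/-! ### Choice of the root κ and conclusion -/

theorem Complex.exists_sq_eq_neg_re_neg {z : ℂ} (hz : z ∉ Complex.ofReal '' Set.Ici 0) :
    ∃ κ : ℂ, κ ^ 2 = -z ∧ κ.re < 0 := by
  obtain ⟨κ, hκ⟩ := IsAlgClosed.exists_pow_nat_eq (-z) two_pos
  rcases lt_trichotomy κ.re 0 with h | h | h
  · exact ⟨κ, hκ, h⟩
  -- A purely imaginary root gives z = -κ² = (Im κ)² ≥ 0.
  · refine absurd ⟨κ.im ^ 2, Set.mem_Ici.2 (sq_nonneg κ.im), ?_⟩ hz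
    have h1 : κ = κ.im * Complex.I := by
      apply Complex.ext <;> simp [h]
    rw [← neg_eq_iff_eq_neg] at hκ
    rw [← hκ, h1]
    simp [mul_pow]
  · exact ⟨-κ, by rw [neg_sq, hκ], by simpa using h⟩

end

theorem mainTheorem11 {V E I : Type*} [Finite V] [Fintype E] [Fintype I]
    (G : MetricGraph V E I)
    (A B : MetricGraph.BoundarySpace E I →ₗ[ℂ] MetricGraph.BoundarySpace E I)
    (hAB : MetricGraph.IsRegular A B) :
    (-G.laplacian A B).residualSpectrum ⊆ Complex.ofReal '' Set.Ici 0 ∧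
      (IsEmpty E ∨ IsEmpty I → (-G.laplacian A B).residualSpectrum = ∅) := by
  have hsub : (-G.laplacian A B).residualSpectrum ⊆ Complex.ofReal '' Set.Ici 0 := by
    intro z hz
    by_contra hz'
    obtain ⟨κ, hκ, hre⟩ := Complex.exists_sq_eq_neg_re_neg hz'
    exact G.notMem_residualSpectrum_of_sol A B hAB.1 hκ (.inr hre) hz
  refine ⟨hsub, fun h => Set.eq_empty_iff_forall_notMem.2 fun z hz => ?_⟩
  rcases h with hE | hI
  -- Every solution on a compact interval is square integrable, so the sign of Re κ is irrelevant.
  · obtain ⟨κ, hκ⟩ := IsAlgClosed.exists_pow_nat_eq (-z) two_pos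
    exact G.notMem_residualSpectrum_of_sol A B hAB.1 hκ (.inl hE) hz
  · obtain ⟨r, hr, rfl⟩ := hsub hz
    refine G.notMem_residualSpectrum_of_isEmpty A B (Real.sqrt_nonneg r) ?_
    rwa [Real.sq_sqrt hr]
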